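/- Let $N$ be a finitely generated nilpotent group and let $\varphi$ be an automorphism of $N$ whose induced map $\varphi_*$ on $H_1(N,\mathbb{Q})$ is unipotent, that is, $(\varphi_*-\mathrm{id})^m=0$ for some $m\ge 0$. For a finite generating set $S$ of $N$ and $h\in N$ let $\ell_S(h)=d(h,1)$ be the word length, where $d$ is the graph metric of the Cayley graph of $N$ with respect to $S$. Then there is a real number $r>1$, depending only on $N$ and $\varphi$, such that for every finite generating set $S$ of $N$ and every $g\in N$, \[\ell_S(\varphi^n(g))=O(n^r)\qquad (n\to\infty),\] where the implied constant may depend on $S$ and $g$. -/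

import Mathlib

open Filter Asymptotics CategoryTheory

universe u

noncomputable section

/-- The word length `ℓ_S(g) = d(g, 1)`, where `d` is the graph metric of the Cayley graph of `G`
with respect to `S` (an edge joins `x` and `x * s` for `x ∈ G`, `s ∈ S`). It is used only for `S`
a generating set, for which the Cayley graph is connected. -/
def wordLength {G : Type u} [Group G] (S : Set G) (g : G) : ℕ :=
  (SimpleGraph.mulCayley S).dist g 1

/-- The field of rational numbers, placed in the universe `u`, because Mathlib's group homology
needs the group and the coefficient ring in the same universe. -/
abbrev RatU : Type u := ULift.{u} ℚ

/-- The trivial representation of `G` on `ℚ`. -/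
abbrev trivialRat (G : Type u) [Group G] : Rep.{u} RatU.{u} G :=
  Rep.trivial RatU.{u} G RatU.{u}

/-- The first rational homology group `H₁(G, ℚ)`, a rational vector space. -/
abbrev H1Rat (G : Type u) [Group G] : ModuleCat.{u} RatU.{u} :=
  groupHomology (trivialRat G) 1

/-- The endomorphism `φ_*` of `H₁(G, ℚ)` induced by an automorphism `φ` of `G`
(with the identity map on the coefficients `ℚ`). -/
def H1RatMap {G : Type u} [Group G] (φ : MulAut G) : Module.End RatU.{u} (H1Rat G) :=
  (groupHomology.map (A := trivialRat G) (B := trivialRat G) φ.toMonoidHom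
    (Rep.ofHom ⟨LinearMap.id, fun _ => rfl⟩) 1).hom

/-- `f` is unipotent: `(f - 1) ^ m = 0` for some `m`. -/
def IsUnipotentEnd {k V : Type*} [CommRing k] [AddCommGroup V] [Module k V]
    (f : Module.End k V) : Prop :=
  IsNilpotent (f - 1)

end

/-!
Write `D g = g⁻¹ φ(g)` for the displacement. Since `φⁿ⁺¹(g) = φⁿ(g) φⁿ(D g)`, a bound `O(n ^ d)`
for the length of `φⁿ(D g)` sums up to a bound `O(n ^ (d + 1))` for the length of `φⁿ(g)`
(`mem_polyGrowthSubgroup_succ`). The elements whose orbits grow polynomially form a subgroup `X`,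
and `D g ∈ X` implies `g ∈ X`; no comparison of word metrics on subgroups, hence no estimate of
distortion, is needed. If some power of `D` maps `N` into its commutator subgroup, that is, if `φ`
is unipotent on the abelianization, then such an `X` is everything
(`eq_top_of_displacement`): the commutator pairing
`Γ i × N → Γ (i + 1) / Γ (i + 2)` is bimultiplicative and equivariant, so unipotence propagates down
the lower central series (`lowerCentralSeries_le_of_displacement`), which reaches `1`.

The hypothesis concerns `H₁(N, ℚ) ≅ Nᵃᵇ ⊗ ℚ`, so it only says that a power of `φ - 1` maps `Nᵃᵇ` into
its torsion subgroup. That subgroup is finite, so a power `φ ^ k` with `k > 0` is trivial on it, and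
`φ ^ k` is unipotent on `Nᵃᵇ` itself (`exists_pow_displacement_iterate_mem_commutator`).
Polynomial growth passes from `φ ^ k` back to `φ` by division with remainder
(`polyGrowthSubgroup_eq_top_of_pow`), and the degree is uniform because `N` is finitely generated
(`exists_polyGrowthSubgroup_eq_top`).
-/

/-! ### Word length -/

section WordLength

variable {G : Type u} [Group G] {S : Set G}

/-- Left translation by `a`, as an endomorphism of the Cayley graph. -/
def mulCayleyTranslate (S : Set G) (a : G) :
    SimpleGraph.mulCayley S →g SimpleGraph.mulCayley S where
  toFun x := a * x
  map_rel' h := SimpleGraph.mulCayley_adj_mul_iff_right.2 h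

theorem mulCayley_reachable_one (hS : Subgroup.closure S = ⊤) (g : G) :
    (SimpleGraph.mulCayley S).Reachable g 1 := by
  have hg : g ∈ Subgroup.closure S := hS ▸ Subgroup.mem_top g
  induction hg using Subgroup.closure_induction with
  | mem x hx =>
    rcases eq_or_ne x 1 with rfl | h1
    · exact SimpleGraph.Reachable.refl _
    · exact SimpleGraph.Adj.reachable ((SimpleGraph.mulCayley_adj S x 1).2 ⟨h1, by simp [hx]⟩)
  | one => exact SimpleGraph.Reachable.refl _
  | mul x y _ _ hx hy =>
    have := hy.map (mulCayleyTranslate S x)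
    simp only [mulCayleyTranslate, RelHom.coeFn_mk, mul_one] at this
    exact this.trans hx
  | inv x _ hx =>
    have := hx.map (mulCayleyTranslate S x⁻¹)
    simp only [mulCayleyTranslate, RelHom.coeFn_mk, mul_one, inv_mul_cancel] at this
    exact this.symm

theorem mulCayley_connected (hS : Subgroup.closure S = ⊤) :
    (SimpleGraph.mulCayley S).Connected :=
  (SimpleGraph.connected_iff_exists_forall_reachable _).2
    ⟨1, fun g => (mulCayley_reachable_one hS g).symm⟩

theorem mulCayley_dist_mul_left_le (hS : Subgroup.closure S = ⊤) (a x y : G) :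
    (SimpleGraph.mulCayley S).dist (a * x) (a * y) ≤ (SimpleGraph.mulCayley S).dist x y := by
  obtain ⟨p, hp⟩ := (mulCayley_connected hS).exists_walk_length_eq_dist x y
  rw [← hp, ← p.length_map (mulCayleyTranslate S a)]
  exact SimpleGraph.dist_le _

theorem wordLength_one : wordLength S (1 : G) = 0 := SimpleGraph.dist_self

theorem wordLength_mul_le (hS : Subgroup.closure S = ⊤) (g h : G) :
    wordLength S (g * h) ≤ wordLength S g + wordLength S h := by
  have h1 := (mulCayley_connected hS).dist_triangle (u := g * h) (v := g) (w := 1)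
  have h2 := mulCayley_dist_mul_left_le hS g h 1
  rw [mul_one] at h2
  unfold wordLength
  lia

theorem wordLength_inv_le (hS : Subgroup.closure S = ⊤) (g : G) :
    wordLength S g⁻¹ ≤ wordLength S g := by
  have := mulCayley_dist_mul_left_le hS g⁻¹ 1 g
  rwa [mul_one, inv_mul_cancel, SimpleGraph.dist_comm (u := 1)] at this

end WordLength

/-! ### Polynomial growth of orbits -/

section Growth

variable {G : Type u} [Group G]

/-- The displacement `g⁻¹ ψ(g)` of `g` under an automorphism `ψ`. In an abelian group, written
additively, this is `ψ - 1`. -/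
def displacement (ψ : MulAut G) (g : G) : G := g⁻¹ * ψ g

/-- The elements `g` whose orbit `ψⁿ(g)` has word length `O(n ^ d)` with respect to every finite
generating set. The bound uses `(n + 1) ^ d` so that it can hold for all `n`, including `n = 0`. -/
def polyGrowthSubgroup (ψ : MulAut G) (d : ℕ) : Subgroup G where
  carrier := {g | ∀ S : Finset G, Subgroup.closure (S : Set G) = ⊤ →
    ∃ C : ℕ, ∀ n : ℕ, wordLength (S : Set G) ((ψ ^ n) g) ≤ C * (n + 1) ^ d}
  one_mem' S _ := ⟨0, fun n => by simp [wordLength_one]⟩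
  mul_mem' {a b} ha hb S hS := by
    obtain ⟨C, hC⟩ := ha S hS
    obtain ⟨C', hC'⟩ := hb S hS
    refine ⟨C + C', fun n => ?_⟩
    rw [map_mul, add_mul]
    exact (wordLength_mul_le hS _ _).trans (add_le_add (hC n) (hC' n))
  inv_mem' {a} ha S hS := by
    obtain ⟨C, hC⟩ := ha S hS
    refine ⟨C, fun n => ?_⟩
    rw [map_inv]
    exact (wordLength_inv_le hS _).trans (hC n)

theorem mem_polyGrowthSubgroup {ψ : MulAut G} {d : ℕ} {g : G} :
    g ∈ polyGrowthSubgroup ψ d ↔ ∀ S : Finset G, Subgroup.closure (S : Set G) = ⊤ →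
      ∃ C : ℕ, ∀ n : ℕ, wordLength (S : Set G) ((ψ ^ n) g) ≤ C * (n + 1) ^ d := Iff.rfl

theorem polyGrowthSubgroup_mono (ψ : MulAut G) : Monotone (polyGrowthSubgroup ψ) := by
  intro d e hde g hg S hS
  obtain ⟨C, hC⟩ := hg S hS
  exact ⟨C, fun n => (hC n).trans
    (Nat.mul_le_mul_left _ (Nat.pow_le_pow_right n.succ_pos hde))⟩

/-- Summation: `ψⁿ⁺¹(g) = ψⁿ(g) ψⁿ(g⁻¹ ψ(g))`, so the word length of `ψⁿ(g)` is at most a sum of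
`n` terms, each the length of an iterate of the displacement. -/
theorem mem_polyGrowthSubgroup_succ {ψ : MulAut G} {d : ℕ} {g : G}
    (hg : displacement ψ g ∈ polyGrowthSubgroup ψ d) : g ∈ polyGrowthSubgroup ψ (d + 1) := by
  intro S hS
  obtain ⟨C, hC⟩ := hg S hS
  refine ⟨wordLength (S : Set G) g + C, fun n => ?_⟩
  induction n with
  | zero => simp
  | succ n ih =>
    have h1 : (ψ ^ (n + 1)) g = (ψ ^ n) g * (ψ ^ n) (displacement ψ g) := by
      rw [← map_mul, displacement, mul_inv_cancel_left, pow_succ, MulAut.mul_apply]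
    set K := wordLength (S : Set G) g
    calc wordLength (S : Set G) ((ψ ^ (n + 1)) g)
        ≤ (K + C) * (n + 1) ^ (d + 1) + C * (n + 1) ^ d := by
          rw [h1]
          exact (wordLength_mul_le hS _ _).trans (add_le_add ih (hC n))
      _ ≤ (K + C) * (n + 1) ^ (d + 1) + (K + C) * (n + 1) ^ d := by gcongr; lia
      _ = (K + C) * ((n + 1) ^ d * (n + 1 + 1)) := by ring
      _ ≤ (K + C) * (n + 1 + 1) ^ (d + 1) := by
          rw [pow_succ]; gcongr; lia

theorem mem_iSup_polyGrowthSubgroup {ψ : MulAut G} {g : G} :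
    g ∈ ⨆ d, polyGrowthSubgroup ψ d ↔ ∃ d, g ∈ polyGrowthSubgroup ψ d :=
  Subgroup.mem_iSup_of_directed (polyGrowthSubgroup_mono ψ).directed_le

/-- For a finitely generated group the degree can be chosen uniformly in the element. -/
theorem exists_polyGrowthSubgroup_eq_top [Group.FG G] {ψ : MulAut G}
    (h : ⨆ d, polyGrowthSubgroup ψ d = ⊤) : ∃ d, polyGrowthSubgroup ψ d = ⊤ := by
  obtain ⟨S, hS⟩ := Group.fg_def.1 ‹Group.FG G›
  choose d hd using fun g : G =>
    mem_iSup_polyGrowthSubgroup.1 (h ▸ Subgroup.mem_top g : g ∈ ⨆ d, polyGrowthSubgroup ψ d)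
  refine ⟨S.sup d, top_le_iff.1 ?_⟩
  rw [← hS, Subgroup.closure_le]
  exact fun g hg => polyGrowthSubgroup_mono ψ (Finset.le_sup hg) (hd g)

/-- Polynomial growth along a power `φ ^ k` gives polynomial growth along `φ`, by splitting `n`
into its quotient and remainder modulo `k`. -/
theorem polyGrowthSubgroup_eq_top_of_pow {φ : MulAut G} {k d : ℕ} (hk : 0 < k)
    (h : polyGrowthSubgroup (φ ^ k) d = ⊤) : polyGrowthSubgroup φ d = ⊤ := by
  rw [eq_top_iff]
  intro g _ S hS
  choose C hC using fun r : ℕ =>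
    mem_polyGrowthSubgroup.1 (h ▸ Subgroup.mem_top ((φ ^ r) g)) S hS
  refine ⟨∑ r ∈ Finset.range k, C r, fun n => ?_⟩
  have h1 : (φ ^ n) g = ((φ ^ k) ^ (n / k)) ((φ ^ (n % k)) g) := by
    rw [← MulAut.mul_apply, ← pow_mul, ← pow_add, Nat.div_add_mod]
  rw [h1]
  refine (hC _ _).trans (Nat.mul_le_mul ?_ (Nat.pow_le_pow_left ?_ d))
  · exact Finset.single_le_sum (f := C) (fun _ _ => Nat.zero_le _)
      (Finset.mem_range.2 (Nat.mod_lt n hk))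
  · exact Nat.succ_le_succ (Nat.div_le_self n k)

end Growth

/-! ### Unipotence along the lower central series -/

section LowerCentralSeries

open scoped commutatorElement

variable {G : Type u} [Group G]

local notation "Γ" => Subgroup.lowerCentralSeries (⊤ : Subgroup G)

theorem commutatorElement_mem_lowerCentralSeries_succ {i : ℕ} {a : G} (ha : a ∈ Γ i) (b : G) :
    ⁅a, b⁆ ∈ Γ (i + 1) :=
  Subgroup.commutator_mem_commutator ha (Subgroup.mem_top b)

theorem displacement_mem_lowerCentralSeries {ψ : MulAut G} {i : ℕ} {a : G} (ha : a ∈ Γ i) :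
    displacement ψ a ∈ Γ i := by
  refine mul_mem (inv_mem ha) ?_
  have := Subgroup.characteristic_iff_map_le.1
    (Subgroup.lowerCentralSeries_characteristic (⊤ : Subgroup G) i) ψ
  exact this (Subgroup.mem_map_of_mem _ ha)

/-- `Γ i` is central modulo `Γ (i + 1)`, so conjugation does not move its elements out of a
subgroup containing `Γ (i + 1)`. -/
theorem conj_mem_of_lowerCentralSeries_succ_le {X : Subgroup G} {i : ℕ} (hX : Γ (i + 1) ≤ X)
    {z : G} (hz : z ∈ Γ i) (hzX : z ∈ X) (a : G) : a * z * a⁻¹ ∈ X := by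
  have h1 : a * z * a⁻¹ = ⁅z, a⁆⁻¹ * z := by
    rw [commutatorElement_inv, commutatorElement_def]; group
  rw [h1]
  exact mul_mem (inv_mem (hX (commutatorElement_mem_lowerCentralSeries_succ hz a))) hzX

/-- Commutation with a fixed element of `Γ i` is a homomorphism to the abelian group
`Γ (i + 1) / Γ (i + 2)`, hence kills commutators. -/
theorem commutatorElement_mem_lowerCentralSeries_add_two {i : ℕ} {a b : G} (ha : a ∈ Γ i)
    (hb : b ∈ commutator G) : ⁅a, b⁆ ∈ Γ (i + 2) := by
  let Q := G ⧸ Γ (i + 2)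
  have hcen (g : G) : ((⁅a, g⁆ : G) : Q) ∈ Subgroup.center Q := by
    refine Subgroup.mem_center_iff.2 fun q => ?_
    obtain ⟨w, rfl⟩ := QuotientGroup.mk_surjective q
    rw [← QuotientGroup.mk_mul, ← QuotientGroup.mk_mul, eq_comm, QuotientGroup.eq]
    have := commutatorElement_mem_lowerCentralSeries_succ (inv_mem
      (commutatorElement_mem_lowerCentralSeries_succ ha g)) w⁻¹
    have h1 : (⁅a, g⁆ * w)⁻¹ * (w * ⁅a, g⁆) = ⁅w⁻¹, ⁅a, g⁆⁻¹⁆ := by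
      rw [commutatorElement_def w⁻¹]; group
    rw [h1, ← commutatorElement_inv]
    exact inv_mem this
  let f : G →* Q :=
    { toFun g := ((⁅a, g⁆ : G) : Q)
      map_one' := by rw [commutatorElement_one_right, QuotientGroup.mk_one]
      map_mul' u v := by
        have h1 := Subgroup.mem_center_iff.1 (hcen v) (u : Q)
        rw [commutatorElement_mul_right_eq_mul_conj]
        simp only [QuotientGroup.mk_mul, QuotientGroup.mk_inv]
        rw [mul_assoc _ (u : Q), h1, ← mul_assoc, mul_inv_cancel_right] }
  have hker : commutator G ≤ f.ker := Subgroup.commutator_le.2 fun u _ v _ => by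
    rw [MonoidHom.mem_ker, map_commutatorElement, commutatorElement_eq_one_iff_mul_comm]
    exact Subgroup.mem_center_iff.1 (hcen v) _
  exact (QuotientGroup.eq_one_iff _).1 (hker hb)

/-- Unipotence of `ψ` on the abelianization propagates to `Γ i / Γ (i + 1)`, through the
bimultiplicative commutator pairing `Γ i × G → Γ (i + 1) / Γ (i + 2)`. Unipotence on
`Γ i / Γ (i + 1)` is phrased without quotients: a subgroup `X ⊇ Γ (i + 1)` contains `Γ i` as soon as
it contains every `g ∈ Γ i` whose displacement lies in `X`. Quantifying over all `X` makes the
induction work. -/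
theorem lowerCentralSeries_le_of_displacement {ψ : MulAut G} {m : ℕ}
    (hm : ∀ g, (displacement ψ)^[m] g ∈ commutator G) (i : ℕ) :
    ∀ X : Subgroup G, Γ (i + 1) ≤ X →
      (∀ g ∈ Γ i, displacement ψ g ∈ X → g ∈ X) → Γ i ≤ X := by
  induction i with
  | zero =>
    intro X hX h g _
    have key : ∀ l, ∀ g, (displacement ψ)^[l] g ∈ commutator G → g ∈ X := by
      intro l
      induction l with
      | zero => exact fun g hg => hX hg
      | succ l ih => exact fun g hg => h g (Subgroup.mem_top g) (ih _ hg)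
    exact key m g (hm g)
  | succ i ihi =>
    intro X hX h
    -- Induction on the number of displacements that bring `b` into the commutator subgroup.
    have key : ∀ l, ∀ a ∈ Γ i, ∀ b, (displacement ψ)^[l] b ∈ commutator G → ⁅a, b⁆ ∈ X := by
      intro l
      induction l with
      | zero => exact fun a ha b hb => hX (commutatorElement_mem_lowerCentralSeries_add_two ha hb)
      | succ l ihl =>
        -- The elements of `Γ i` pairing into `X` with every such `b` form a subgroup, to which
        -- the hypothesis on `Γ i` applies.
        let W : Subgroup G :=
          { carrier := {a | a ∈ Γ i ∧
              ∀ b, (displacement ψ)^[l + 1] b ∈ commutator G → ⁅a, b⁆ ∈ X}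
            one_mem' := ⟨one_mem _, fun b _ => by rw [commutatorElement_one_left]; exact one_mem _⟩
            mul_mem' := fun {x y} hx hy => ⟨mul_mem hx.1 hy.1, fun b hb => by
              rw [commutatorElement_mul_left_eq_conj_mul]
              exact mul_mem (conj_mem_of_lowerCentralSeries_succ_le hX
                (commutatorElement_mem_lowerCentralSeries_succ hy.1 b) (hy.2 b hb) x)
                (hx.2 b hb)⟩
            inv_mem' := fun {x} hx => ⟨inv_mem hx.1, fun b hb => by
              have := conj_mem_of_lowerCentralSeries_succ_le hX
                (inv_mem (commutatorElement_mem_lowerCentralSeries_succ hx.1 b))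
                (inv_mem (hx.2 b hb)) x⁻¹
              rwa [commutatorElement_inv, inv_inv, ← commutatorElement_inv_left] at this⟩ }
        have hW : Γ i ≤ W := by
          refine ihi W ?_ ?_
          · intro a ha
            exact ⟨Subgroup.lowerCentralSeries_antitone _ i.le_succ ha, fun b _ =>
              hX (commutatorElement_mem_lowerCentralSeries_succ ha b)⟩
          · intro a ha hDa
            refine ⟨ha, fun b hb => ?_⟩
            refine h _ (commutatorElement_mem_lowerCentralSeries_succ ha b) ?_
            set x := displacement ψ a with hx
            set y := displacement ψ b with hy
            have hxi : x ∈ Γ i := displacement_mem_lowerCentralSeries ha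
            have hψa : ψ a = a * x := by rw [hx, displacement, mul_inv_cancel_left]
            have hψb : ψ b = b * y := by rw [hy, displacement, mul_inv_cancel_left]
            have hyl : (displacement ψ)^[l] y ∈ commutator G := hb
            -- `⁅a, b⁆⁻¹ ⁅a x, b y⁆` is a product of conjugates of `⁅x, b y⁆` and `⁅a, y⁆`.
            have h1 : displacement ψ ⁅a, b⁆
                = (⁅a, b⁆⁻¹ * a) * ⁅x, b * y⁆ * (⁅a, b⁆⁻¹ * a)⁻¹ * (b * ⁅a, y⁆ * b⁻¹) := by
              rw [displacement, map_commutatorElement, hψa, hψb,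
                commutatorElement_mul_left_eq_conj_mul a x, commutatorElement_mul_right_eq_mul_conj a]
              group
            have h2 : ⁅a, y⁆ ∈ X := ihl a ha y hyl
            have h3 : ⁅x, b * y⁆ ∈ X := by
              rw [commutatorElement_mul_right_eq_mul_conj, mul_assoc, mul_assoc, ← mul_assoc b]
              exact mul_mem (hDa.2 b hb) (conj_mem_of_lowerCentralSeries_succ_le hX
                (commutatorElement_mem_lowerCentralSeries_succ hxi y) (ihl x hxi y hyl) b)
            rw [h1]
            exact mul_mem
              (conj_mem_of_lowerCentralSeries_succ_le hX
                (commutatorElement_mem_lowerCentralSeries_succ hxi _) h3 _)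
              (conj_mem_of_lowerCentralSeries_succ_le hX
                (commutatorElement_mem_lowerCentralSeries_succ ha y) h2 b)
        exact fun a ha b hb => (hW ha).2 b hb
    rw [Subgroup.lowerCentralSeries_succ, Subgroup.commutator_le]
    exact fun a ha b _ => key m a ha b (hm b)

/-- If `ψ` is unipotent on the abelianization of a nilpotent group, the only subgroup that contains
every element whose displacement it contains is the whole group. -/
theorem eq_top_of_displacement [Group.IsNilpotent G] {ψ : MulAut G} {m : ℕ}
    (hm : ∀ g, (displacement ψ)^[m] g ∈ commutator G) {X : Subgroup G}
    (hX : ∀ g, displacement ψ g ∈ X → g ∈ X) : X = ⊤ := by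
  obtain ⟨c, hc⟩ := Subgroup.nilpotent_iff_lowerCentralSeries.1 ‹Group.IsNilpotent G›
  have key : ∀ i ≤ c, Γ (c - i) ≤ X := by
    intro i
    induction i with
    | zero => intro _; rw [Nat.sub_zero, hc]; exact bot_le
    | succ i ih =>
      intro hi
      refine lowerCentralSeries_le_of_displacement hm _ X ?_ fun g _ => hX g
      rw [show c - (i + 1) + 1 = c - i by lia]
      exact ih (by lia)
  have := key c le_rfl
  rwa [Nat.sub_self, Subgroup.lowerCentralSeries_zero, top_le_iff] at this

end LowerCentralSeries

/-! ### Rational homology and the abelianization -/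

open TensorProduct

instance isLocalization_ratU : IsLocalization (nonZeroDivisors ℤ) RatU.{u} :=
  IsLocalization.isLocalization_of_algEquiv (nonZeroDivisors ℤ)
    (ULift.algEquiv (R := ℤ) (A := ℚ)).symm

/-- The kernel of `A → A ⊗ ℚ` is torsion, because `A ⊗ ℚ` is the localization of `A` at the nonzero
integers. -/
theorem isOfFinAddOrder_of_tmul_ratU_eq_zero {A : Type*} [AddCommGroup A] {x : A}
    (h : x ⊗ₜ[ℤ] (1 : RatU.{u}) = 0) : IsOfFinAddOrder x := by
  have h1 : (TensorProduct.mk ℤ RatU.{u} A 1) x = 0 := by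
    have := congrArg (TensorProduct.comm ℤ A RatU.{u}) h
    simpa using this
  have : IsLocalizedModule (nonZeroDivisors ℤ) (TensorProduct.mk ℤ RatU.{u} A 1) :=
    (isLocalizedModule_iff_isBaseChange (nonZeroDivisors ℤ) RatU.{u} _).2
      (TensorProduct.isBaseChange ℤ A RatU.{u})
  obtain ⟨s, hs⟩ := (IsLocalizedModule.eq_zero_iff (nonZeroDivisors ℤ) _).1 h1
  exact isOfFinAddOrder_iff_zsmul_eq_zero.2 ⟨s, nonZeroDivisors.coe_ne_zero s, hs⟩

section H1

variable {N : Type u} [Group N]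

/-- The map `Nᵃᵇ → H₁(N, ℚ)` sending the class of `g` to the class of the chain `g ⊗ 1`. -/
noncomputable def abToH1Rat (N : Type u) [Group N] : Additive (Abelianization N) →+ H1Rat N :=
  (((groupHomology.mkH1OfIsTrivial (trivialRat N)).flip (1 : RatU.{u}))).toAddMonoidHom

theorem isOfFinAddOrder_of_abToH1Rat_eq_zero {x : Additive (Abelianization N)}
    (h : abToH1Rat N x = 0) : IsOfFinAddOrder x := by
  apply isOfFinAddOrder_of_tmul_ratU_eq_zero.{u}
  apply (groupHomology.H1AddEquivOfIsTrivial (trivialRat N)).symm.injective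
  rw [map_zero]
  -- By `H1AddEquivOfIsTrivial_symm_tmul`, the left-hand side is `abToH1Rat N x` by definition.
  exact h

/-- The endomorphism of the abelianization, as a `ℤ`-module, induced by `φ`. -/
def abEnd (φ : MulAut N) : Module.End ℤ (Additive (Abelianization N)) :=
  (MonoidHom.toAdditive (Abelianization.map φ.toMonoidHom)).toIntLinearMap

theorem abEnd_of (φ : MulAut N) (g : N) :
    abEnd φ (Additive.ofMul (Abelianization.of g)) = Additive.ofMul (Abelianization.of (φ g)) := rfl

/-- Naturality of the map `Nᵃᵇ → H₁(N, ℚ)`. -/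
theorem abToH1Rat_abEnd (φ : MulAut N) (x : Additive (Abelianization N)) :
    abToH1Rat N (abEnd φ x) = H1RatMap φ (abToH1Rat N x) := by
  obtain ⟨g, rfl⟩ : ∃ g : N, Additive.ofMul (Abelianization.of g) = x :=
    QuotientGroup.mk_surjective x
  rw [abEnd_of]
  change groupHomology.H1π _ _ = (groupHomology.map _ _ 1).hom (groupHomology.H1π _ _)
  -- `H1Rat N` is the Mathlib type `H1 (trivialRat N)` only up to unfolding, hence `erw`.
  erw [groupHomology.H1π_comp_map_apply]
  congr 1
  apply Subtype.ext
  change Finsupp.single (φ g) (1 : RatU.{u}) =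
    groupHomology.chainsMap₁ (A := trivialRat N) (B := trivialRat N) φ.toMonoidHom
      (Rep.ofHom ⟨LinearMap.id, fun _ => rfl⟩) (Finsupp.single g (1 : RatU.{u}))
  simp [groupHomology.chainsMap₁]

theorem abEnd_mul (φ ψ : MulAut N) : abEnd (φ * ψ) = abEnd φ * abEnd ψ := by
  ext x
  obtain ⟨g, rfl⟩ : ∃ g : N, Additive.ofMul (Abelianization.of g) = x :=
    QuotientGroup.mk_surjective x
  rfl

theorem abEnd_one : abEnd (1 : MulAut N) = 1 := by
  ext x
  obtain ⟨g, rfl⟩ : ∃ g : N, Additive.ofMul (Abelianization.of g) = x :=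
    QuotientGroup.mk_surjective x
  rfl

theorem abEnd_pow (φ : MulAut N) (k : ℕ) : abEnd (φ ^ k) = abEnd φ ^ k := by
  induction k with
  | zero => rw [pow_zero, pow_zero, abEnd_one]
  | succ k ih => rw [pow_succ, abEnd_mul, ih, pow_succ]

theorem abToH1Rat_abEnd_sub_one_pow (φ : MulAut N) (m : ℕ) (x : Additive (Abelianization N)) :
    abToH1Rat N (((abEnd φ - 1) ^ m) x) = ((H1RatMap φ - 1) ^ m) (abToH1Rat N x) := by
  induction m generalizing x with
  | zero => rfl
  | succ m ih =>
    rw [pow_succ, pow_succ, Module.End.mul_apply, Module.End.mul_apply, ih]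
    simp only [LinearMap.sub_apply, Module.End.one_apply, map_sub, abToH1Rat_abEnd]

theorem ofMul_of_displacement_iterate (φ : MulAut N) (m : ℕ) (g : N) :
    Additive.ofMul (Abelianization.of ((displacement φ)^[m] g)) =
      ((abEnd φ - 1) ^ m) (Additive.ofMul (Abelianization.of g)) := by
  induction m generalizing g with
  | zero => rfl
  | succ m ih =>
    rw [Function.iterate_succ_apply, ih, pow_succ, Module.End.mul_apply]
    congr 1
    rw [displacement, map_mul, map_inv, ofMul_mul, ofMul_inv, LinearMap.sub_apply, abEnd_of,
      Module.End.one_apply, neg_add_eq_sub]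

end H1

/-! ### A power of the automorphism is unipotent on the abelianization -/

/-- A linear bijection of a finitely generated abelian group has a power that is trivial on the
finite torsion subgroup. -/
theorem exists_pow_apply_eq_self_of_isOfFinAddOrder {A : Type*} [AddCommGroup A]
    [Module.Finite ℤ A] {e : Module.End ℤ A} (he : Function.Bijective e) :
    ∃ k, 0 < k ∧ ∀ x, IsOfFinAddOrder x → (e ^ k) x = x := by
  have hfin : Finite (AddCommGroup.torsion A) := by
    have : Module.Finite ℤ (AddCommGroup.torsion A).toIntSubmodule := inferInstance
    have hfin' := Module.finite_of_fg_torsion (AddCommGroup.torsion A).toIntSubmodule ?_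
    · exact hfin'
    · rintro ⟨x, hx⟩
      obtain ⟨n, hn, hx⟩ := isOfFinAddOrder_iff_zsmul_eq_zero.1 hx
      exact ⟨⟨n, mem_nonZeroDivisors_of_ne_zero hn⟩, Subtype.ext hx⟩
  let σ : Equiv.Perm A := Equiv.ofBijective e he
  have hp (x : A) : IsOfFinAddOrder (σ x) ↔ IsOfFinAddOrder x :=
    Function.Injective.isOfFinAddOrder_iff (f := e.toAddMonoidHom) he.1
  have hfin' : Finite {x : A // IsOfFinAddOrder x} := hfin
  refine ⟨orderOf (σ.subtypePerm hp), orderOf_pos _, fun x hx => ?_⟩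
  have h1 := congrArg (fun τ => (τ ⟨x, hx⟩ : A)) (pow_orderOf_eq_one (σ.subtypePerm hp))
  rw [Equiv.Perm.subtypePerm_pow] at h1
  rw [Module.End.pow_apply]
  refine Eq.trans ?_ h1
  exact congrFun (Equiv.Perm.iterate_eq_pow σ _) x

/-- If `(e - 1) ^ m` has torsion image and `e ^ k` is trivial on torsion, then `e ^ k` is unipotent:
`e ^ k - 1` is a multiple of `e - 1`, so its `m`-th power also has torsion image, which one more
factor `e ^ k - 1` kills. -/
theorem pow_sub_one_pow_succ_eq_zero {A : Type*} [AddCommGroup A] {e : Module.End ℤ A} {k m : ℕ}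
    (hk : ∀ x, IsOfFinAddOrder x → (e ^ k) x = x)
    (hm : ∀ x, IsOfFinAddOrder (((e - 1) ^ m) x)) : (e ^ k - 1) ^ (m + 1) = 0 := by
  have hc : (e ^ k - 1) ^ m = (∑ i ∈ Finset.range k, e ^ i) ^ m * (e - 1) ^ m := by
    rw [← geom_sum_mul, Commute.mul_pow]
    exact Commute.sum_left _ _ _ fun i _ =>
      (((Commute.refl e).sub_right (Commute.one_right e)).pow_left i)
  ext x
  rw [pow_succ', Module.End.mul_apply, LinearMap.sub_apply, Module.End.one_apply, hk,
    sub_self, LinearMap.zero_apply]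
  rw [hc, Module.End.mul_apply]
  exact AddMonoidHom.isOfFinAddOrder (LinearMap.toAddMonoidHom _) (hm x)

theorem abEnd_bijective {N : Type u} [Group N] (φ : MulAut N) : Function.Bijective (abEnd φ) := by
  refine Function.bijective_iff_has_inverse.2 ⟨abEnd φ⁻¹, fun x => ?_, fun x => ?_⟩
  · rw [← Module.End.mul_apply, ← abEnd_mul, inv_mul_cancel, abEnd_one, Module.End.one_apply]
  · rw [← Module.End.mul_apply, ← abEnd_mul, mul_inv_cancel, abEnd_one, Module.End.one_apply]

/-- An automorphism that is unipotent on `H₁(N, ℚ)` has a power that is unipotent on the integral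
abelianization. -/
theorem exists_pow_displacement_iterate_mem_commutator {N : Type u} [Group N] [Group.FG N]
    (φ : MulAut N) (hφ : IsUnipotentEnd (H1RatMap φ)) :
    ∃ k, 0 < k ∧ ∃ m, ∀ g, (displacement (φ ^ k))^[m] g ∈ commutator N := by
  obtain ⟨m, hm⟩ := hφ
  have hfg : Group.FG (Abelianization N) := QuotientGroup.fg _
  have hfin : Module.Finite ℤ (Additive (Abelianization N)) :=
    Module.Finite.iff_addGroup_fg.2 inferInstance
  obtain ⟨k, hk, hkx⟩ := exists_pow_apply_eq_self_of_isOfFinAddOrder (abEnd_bijective φ)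
  refine ⟨k, hk, m + 1, fun g => ?_⟩
  have h0 := pow_sub_one_pow_succ_eq_zero (m := m) hkx fun x =>
    isOfFinAddOrder_of_abToH1Rat_eq_zero (by
      rw [abToH1Rat_abEnd_sub_one_pow, hm, LinearMap.zero_apply])
  have h1 := ofMul_of_displacement_iterate (φ ^ k) (m + 1) g
  rw [abEnd_pow, h0, LinearMap.zero_apply] at h1
  exact (QuotientGroup.eq_one_iff _).1 h1

/-! ### Polynomial growth for automorphisms unipotent on rational homology -/

theorem theorem1p6 {N : Type u} [Group N] [Group.FG N] [Group.IsNilpotent N] (φ : MulAut N)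
    (hφ : IsUnipotentEnd (H1RatMap φ)) :
    ∃ r : ℝ, 1 < r ∧
      ∀ S : Finset N, Subgroup.closure (S : Set N) = ⊤ →
        ∀ g : N,
          (fun n : ℕ => (wordLength (S : Set N) ((φ ^ n) g) : ℝ)) =O[atTop]
            (fun n : ℕ => (n : ℝ) ^ r) := by
  obtain ⟨k, hk, m, hm⟩ := exists_pow_displacement_iterate_mem_commutator φ hφ
  have htop : ⨆ d, polyGrowthSubgroup (φ ^ k) d = ⊤ :=
    eq_top_of_displacement hm fun g hg => by
      obtain ⟨d, hd⟩ := mem_iSup_polyGrowthSubgroup.1 hg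
      exact mem_iSup_polyGrowthSubgroup.2 ⟨d + 1, mem_polyGrowthSubgroup_succ hd⟩
  obtain ⟨d, hd⟩ := exists_polyGrowthSubgroup_eq_top htop
  have hφd := polyGrowthSubgroup_eq_top_of_pow hk hd
  -- The degree `d` may be `0`; adding `2` makes the exponent exceed `1`.
  refine ⟨((d + 2 : ℕ) : ℝ), by exact_mod_cast (by lia : 1 < d + 2), fun S hS g => ?_⟩
  obtain ⟨C, hC⟩ := mem_polyGrowthSubgroup.1 (hφd ▸ Subgroup.mem_top g) S hS
  refine IsBigO.of_bound ((C * 2 ^ d : ℕ) : ℝ) (eventually_atTop.2 ⟨1, fun n hn => ?_⟩)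
  rw [Real.rpow_natCast, Real.norm_natCast, norm_pow, Real.norm_natCast]
  have h1 : wordLength (S : Set N) ((φ ^ n) g) ≤ C * 2 ^ d * n ^ (d + 2) :=
    calc wordLength (S : Set N) ((φ ^ n) g) ≤ C * (n + 1) ^ d := hC n
      _ ≤ C * (2 * n) ^ d := by gcongr; lia
      _ = C * 2 ^ d * n ^ d := by rw [mul_pow, mul_assoc]
      _ ≤ C * 2 ^ d * n ^ (d + 2) := by gcongr; lia
  exact_mod_cast h1
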